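/- All digraphs are finite, without loops and without parallel arcs (opposite arcs $xy$ and $yx$ are allowed). A digraph, or a subgraph of a digraph, is \emph{strong} if each of its vertices can be reached from each of its vertices by a directed path inside it. For a digraph $D$ of order $n$ (that is, with $n$ vertices), an integer $k$ with $2\le k\le n$, and a set $S\subseteq V(D)$ with $|S|=k$, let $\lambda_S(D)$ be the maximum number of pairwise arc-disjoint strong subgraphs of $D$ each of which contains all vertices of $S$, and let $$\lambda_k(D)=\min\{\lambda_S(D) : S\subseteq V(D),\ |S|=k\}.$$ Let $\overleftrightarrow{K}_n$ be the complete digraph of order $n$, which has both arcs $xy$ and $yx$ for any two distinct vertices $x,y$. \textbf{Theorem.} Let $2\le k\le n$. For every strong digraph $D$ of order $n$, $$1\le\lambda_k(D)\le n-1,$$ and $\lambda_k(D)=n-1$ if and only if $D\cong\overleftrightarrow{K}_n$ and either $k\notin\{4,6\}$, or $k\in\{4,6\}$ and $k<n$. Moreover, both bounds are sharp: for all $2\le k\le n$ there is a strong digraph $D$ of order $n$ with $\lambda_k(D)=1$, and for all $2\le k\le n$ such that $k\notin\{4,6\}$ or $k<n$ there is a strong digraph $D$ of order $n$ with $\lambda_k(D)=n-1$.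 -/

import Mathlib

namespace StrongSubgraph

/-- A digraph without loops. Parallel arcs do not exist in a `Digraph`. -/
def Loopless {V : Type*} (D : Digraph V) : Prop :=
  ∀ v, ¬ D.Adj v v

/-- A digraph is strong if every vertex can be reached from every vertex by a directed walk. -/
def Strong {V : Type*} (D : Digraph V) : Prop :=
  ∀ x y, Relation.ReflTransGen D.Adj x y

/-- A subgraph of a digraph: a set of vertices and a set of arcs of `D` between them. -/
@[ext]
structure Sub {V : Type*} (D : Digraph V) where
  /-- the vertex set -/
  verts : Set V
  /-- the arc relation -/
  Adj : V → V → Prop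
  adj_sub : ∀ {x y}, Adj x y → D.Adj x y
  tail_mem : ∀ {x y}, Adj x y → x ∈ verts
  head_mem : ∀ {x y}, Adj x y → y ∈ verts

/-- A subgraph is strong if any of its vertices can be reached from any of its vertices by a
directed walk inside the subgraph. -/
def Sub.Strong {V : Type*} {D : Digraph V} (H : Sub D) : Prop :=
  ∀ x ∈ H.verts, ∀ y ∈ H.verts, Relation.ReflTransGen H.Adj x y

/-- Two subgraphs are arc-disjoint if no arc belongs to both. -/
def Sub.ArcDisjoint {V : Type*} {D : Digraph V} (H K : Sub D) : Prop :=
  ∀ x y, ¬ (H.Adj x y ∧ K.Adj x y)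

/-- `D` contains `p` pairwise arc-disjoint strong subgraphs, each of which contains `S`. -/
def HasPacking {V : Type*} (D : Digraph V) (S : Finset V) (p : ℕ) : Prop :=
  ∃ F : Fin p → Sub D,
    (∀ i, (F i).Strong ∧ (S : Set V) ⊆ (F i).verts) ∧
    ∀ i j, i ≠ j → (F i).ArcDisjoint (F j)

/-- `λ_S(D)`: the maximum number of pairwise arc-disjoint strong subgraphs containing `S`.
For a finite digraph and `2 ≤ |S|` this supremum is finite and hence attained. -/
noncomputable def lamS {V : Type*} (D : Digraph V) (S : Finset V) : ℕ∞ :=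
  ⨆ (p : ℕ) (_ : HasPacking D S p), (p : ℕ∞)

/-- `λ_k(D)`, the strong subgraph `k`-arc-connectivity: the minimum of `λ_S(D)` over all sets `S`
of `k` vertices. -/
noncomputable def lam {V : Type*} (D : Digraph V) (k : ℕ) : ℕ∞ :=
  ⨅ (S : Finset V) (_ : S.card = k), lamS D S

/-- The complete digraph of order `n`: both arcs between any two distinct vertices, no loops. -/
def completeDigraph (n : ℕ) : Digraph (Fin n) where
  Adj x y := x ≠ y

/-- Two digraphs are isomorphic. -/
def Isomorphic {V W : Type*} (D : Digraph V) (E : Digraph W) : Prop :=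
  ∃ e : V ≃ W, ∀ x y, D.Adj x y ↔ E.Adj (e x) (e y)

end StrongSubgraph

/-!
The bounds come from out-degrees: a digraph that is strong has a packing of one subgraph, and each
subgraph of a packing leaves a given vertex of `S` along its own arc. Hence `λ_k ≤ n - 1`, and
equality forces every vertex to have out-degree `n - 1`, so that the digraph is complete.

In a complete digraph, a set `T ⊇ S` of `m` vertices whose arcs can be coloured with `m - 1` colours
so that all colour classes are spanning and strong (a `StrongColouring`) gives `n - 1` subgraphs
containing `S`: the colour classes, and the stars joining `T` to the other vertices. Counting arcs,
such a colouring is a decomposition into directed Hamiltonian cycles; it exists for all `m ≥ 2`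
other than `4` and `6`. One takes `T = S`, except that a further vertex is added when `|S|` is `4`
or `6`.

For odd `m = 2h + 1` the zigzag paths `i, i+1, i-1, i+2, …, i+h` of `ℤ/2h` are closed up through one
further point (`strongColouring_odd`). For even `m = 2h + 2` (a theorem of Tillson) two further points
are inserted into the zigzag paths without their first arcs. Together with the cycle of all arcs
`x → x+1` and the `2`-cycle on the two further points, these partition all arcs, and the exchange of
fourteen arcs between four of the classes makes all classes Hamiltonian when `h ≥ 3`
(`strongColouring_even`).

If `k = n` is `4` or `6`, a packing of `n - 1` spanning strong subgraphs would consist of Hamiltonian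
cycles, and a finite search shows that there is no such decomposition (`not_hasPacking_univ`). The
lower bound is attained by the directed cycle.
-/

namespace StrongSubgraph

open Relation

/-! ### Packings and out-degrees -/

section Packing

variable {V : Type*} {D : Digraph V} {S : Finset V} {p q : ℕ}

theorem HasPacking.mono (h : HasPacking D S p) (hqp : q ≤ p) : HasPacking D S q := by
  obtain ⟨F, h₁, h₂⟩ := h
  exact ⟨fun i => F (Fin.castLE hqp i), fun i => h₁ _,
    fun i j hij => h₂ _ _ fun h => hij (Fin.castLE_injective hqp h)⟩

theorem hasPacking_card {ι : Type*} [Fintype ι] (F : ι → Sub D)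
    (hF : ∀ i, (F i).Strong ∧ (S : Set V) ⊆ (F i).verts)
    (hdisj : ∀ i j, i ≠ j → (F i).ArcDisjoint (F j)) : HasPacking D S (Fintype.card ι) := by
  let e := (Fintype.equivFin ι).symm
  exact ⟨fun i => F (e i), fun i => hF _, fun i j hij => hdisj _ _ (e.injective.ne hij)⟩

/-- The supremum defining `lamS` is attained whenever it is at least `p`. -/
theorem natCast_le_lamS : (p : ℕ∞) ≤ lamS D S ↔ HasPacking D S p := by
  refine ⟨fun h => ?_, fun h => le_iSup₂_of_le p h le_rfl⟩
  rcases p with _ | p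
  · exact ⟨Fin.elim0, fun i => i.elim0, fun i => i.elim0⟩
  · have hlt : (p : ℕ∞) < lamS D S := lt_of_lt_of_le (by exact_mod_cast p.lt_succ_self) h
    obtain ⟨q, hq⟩ := lt_iSup_iff.1 hlt
    obtain ⟨hq, hpq⟩ := lt_iSup_iff.1 hq
    exact hq.mono (by exact_mod_cast hpq)

theorem natCast_le_lam {k : ℕ} :
    (p : ℕ∞) ≤ lam D k ↔ ∀ S : Finset V, S.card = k → HasPacking D S p := by
  simp [lam, le_iInf_iff, natCast_le_lamS]

theorem exists_adj_of_reflTransGen {R : V → V → Prop} {x y : V} (h : ReflTransGen R x y)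
    (hxy : x ≠ y) : ∃ z, R x z := by
  obtain rfl | ⟨z, hz, -⟩ := h.cases_head
  · exact absurd rfl hxy
  · exact ⟨z, hz⟩

theorem Sub.Strong.exists_adj {H : Sub D} (hH : H.Strong) (hS : (S : Set V) ⊆ H.verts)
    (hcard : 2 ≤ S.card) {v : V} (hv : v ∈ S) : ∃ w, H.Adj v w := by
  obtain ⟨w, hw, hne⟩ := Finset.exists_mem_ne (by omega : 1 < S.card) v
  exact exists_adj_of_reflTransGen (hH v (hS hv) w (hS hw)) hne.symm

/-- Every subgraph of a packing leaves each vertex of `S` along an arc of its own. -/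
theorem HasPacking.exists_injective (h : HasPacking D S p) (hcard : 2 ≤ S.card) {v : V}
    (hv : v ∈ S) : ∃ f : Fin p → {w // D.Adj v w}, Function.Injective f := by
  obtain ⟨F, h₁, h₂⟩ := h
  choose f hf using fun i => (h₁ i).1.exists_adj (h₁ i).2 hcard hv
  refine ⟨fun i => ⟨f i, (F i).adj_sub (hf i)⟩, fun i j hij => ?_⟩
  by_contra hne
  refine h₂ i j hne v (f i) ⟨hf i, ?_⟩
  rw [show f i = f j from congrArg Subtype.val hij]
  exact hf j

theorem Loopless.ne (hD : Loopless D) {v w : V} (h : D.Adj v w) : w ≠ v := by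
  rintro rfl
  exact hD _ h

theorem card_ne [Fintype V] (v : V) [Fintype {w // w ≠ v}] :
    Fintype.card {w // w ≠ v} = Fintype.card V - 1 := by
  classical
  rw [Fintype.card_subtype_compl, Fintype.card_subtype_eq]

theorem HasPacking.le_card_sub_one [Fintype V] (h : HasPacking D S p) (hD : Loopless D)
    (hcard : 2 ≤ S.card) : p ≤ Fintype.card V - 1 := by
  classical
  obtain ⟨v, hv⟩ := Finset.card_pos.1 (by omega : 0 < S.card)
  obtain ⟨f, hf⟩ := h.exists_injective hcard hv
  have := Fintype.card_le_of_injective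
    (fun i => (⟨f i, hD.ne (f i).2⟩ : {w // w ≠ v}))
    (fun i j hij => hf (Subtype.ext (Subtype.mk.inj hij)))
  rwa [Fintype.card_fin, card_ne] at this

theorem adj_of_hasPacking_card_sub_one [Fintype V]
    (h : HasPacking D S (Fintype.card V - 1)) (hD : Loopless D) (hcard : 2 ≤ S.card) {v w : V}
    (hv : v ∈ S) (hvw : v ≠ w) : D.Adj v w := by
  classical
  obtain ⟨f, hf⟩ := h.exists_injective hcard hv
  let g : Fin (Fintype.card V - 1) → {w // w ≠ v} :=
    fun i => ⟨f i, hD.ne (f i).2⟩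
  have hg : Function.Bijective g := by
    rw [Fintype.bijective_iff_injective_and_card]
    exact ⟨fun i j hij => hf (Subtype.ext (Subtype.mk.inj hij)), by
      rw [Fintype.card_fin, card_ne]⟩
  obtain ⟨i, hi⟩ := hg.2 ⟨w, hvw.symm⟩
  have hw : ((f i : V)) = w := congrArg Subtype.val hi
  exact hw ▸ (f i).2

theorem Strong.hasPacking_one (hD : Strong D) (S : Finset V) : HasPacking D S 1 :=
  ⟨fun _ => ⟨Set.univ, D.Adj, id, fun _ => trivial, fun _ => trivial⟩,
    fun _ => ⟨fun x _ y _ => hD x y, Set.subset_univ _⟩,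
    fun i j hij => absurd (Subsingleton.elim i j) hij⟩

theorem Strong.one_le_lam (hD : Strong D) (k : ℕ) : 1 ≤ lam D k := by
  exact_mod_cast natCast_le_lam.2 fun S _ => hD.hasPacking_one S

theorem lam_le_card_sub_one [Fintype V] (hD : Loopless D) {k : ℕ} (hk : 2 ≤ k)
    (hkV : k ≤ Fintype.card V) : lam D k ≤ ((Fintype.card V - 1 : ℕ) : ℕ∞) := by
  obtain ⟨S, -, hS⟩ := Finset.exists_subset_card_eq
    (s := (Finset.univ : Finset V)) (by simpa using hkV)
  exact iInf₂_le_of_le S hS (iSup₂_le fun p hp => by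
    exact_mod_cast hp.le_card_sub_one hD (hS ▸ hk))

/-- A strong digraph in which each vertex has only one out-neighbour has `λ_k = 1`. -/
theorem lam_eq_one_of_adj_unique [Fintype V] (hD : Strong D)
    (huniq : ∀ x y z, D.Adj x y → D.Adj x z → y = z) {k : ℕ} (hk : 2 ≤ k)
    (hkV : k ≤ Fintype.card V) : lam D k = 1 := by
  refine le_antisymm ?_ (hD.one_le_lam k)
  obtain ⟨S, -, hS⟩ := Finset.exists_subset_card_eq
    (s := (Finset.univ : Finset V)) (by simpa using hkV)
  refine iInf₂_le_of_le S hS (iSup₂_le fun p hp => ?_)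
  obtain ⟨v, hv⟩ := Finset.card_pos.1 (by omega : 0 < S.card)
  obtain ⟨f, hf⟩ := hp.exists_injective (hS ▸ hk) hv
  have hsub : Subsingleton {w // D.Adj v w} :=
    ⟨fun a b => Subtype.ext (huniq v _ _ a.2 b.2)⟩
  have : p ≤ 1 := by
    simpa using Fintype.card_le_one_iff_subsingleton.2 (hf.subsingleton)
  exact_mod_cast this

end Packing

/-! ### From arc colourings of complete digraphs to packings -/

/-- A strong arc colouring of the complete digraph on `V`: the arcs are coloured by `ι` so that
every colour class is a spanning strong subgraph. The colours of the loops `x x` are irrelevant,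
since loops do not affect reachability. -/
def StrongColouring (V ι : Type*) : Prop :=
  ∃ c : V → V → ι, ∀ i x y, ReflTransGen (fun a b => c a b = i) x y

theorem StrongColouring.congr {V W ι κ : Type*} (h : StrongColouring V ι) (e : V ≃ W)
    (f : ι ≃ κ) : StrongColouring W κ := by
  obtain ⟨c, hc⟩ := h
  refine ⟨fun a b => f (c (e.symm a) (e.symm b)), fun i x y => ?_⟩
  have hlift := ReflTransGen.lift (p := fun a b => f (c (e.symm a) (e.symm b)) = i) e
    (fun a b (hab : c a b = f.symm i) => by simp [Function.onFun, hab])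
    (e.symm x) (e.symm y) (hc (f.symm i) (e.symm x) (e.symm y))
  simpa [Function.onFun] using hlift

/-- A strong colouring of a complete digraph on `T ⊇ S`, together with the stars joining `T` to the
vertices outside it, is a packing of the right size. -/
theorem hasPacking_of_strongColouring {V ι : Type*} [Fintype V] [Fintype ι] {D : Digraph V}
    (hD : ∀ x y, D.Adj x y ↔ x ≠ y) {S T : Finset V} (hST : S ⊆ T)
    (hι : Fintype.card ι + 1 = T.card) (h : StrongColouring T ι) :
    HasPacking D S (Fintype.card V - 1) := by
  classical
  obtain ⟨c, hc⟩ := h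
  let F : ι ⊕ {v // v ∉ T} → Sub D := Sum.elim
    (fun i => ⟨T, fun x y => x ≠ y ∧ ∃ (hx : x ∈ T) (hy : y ∈ T), c ⟨x, hx⟩ ⟨y, hy⟩ = i,
      fun h => (hD _ _).2 h.1, fun h => h.2.1, fun h => h.2.2.1⟩)
    (fun v => ⟨insert v.1 (T : Set V), fun x y => (x = v.1 ∧ y ∈ T) ∨ (x ∈ T ∧ y = v.1),
      fun h => (hD _ _).2 (by
        rintro rfl
        rcases h with ⟨h, h'⟩ | ⟨h', h⟩ <;> exact v.2 (h ▸ h')),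
      fun h => by
        rcases h with ⟨h, -⟩ | ⟨h, -⟩
        exacts [Or.inl h, Or.inr h],
      fun h => by
        rcases h with ⟨-, h⟩ | ⟨-, h⟩
        exacts [Or.inr h, Or.inl h]⟩)
  have hcard : Fintype.card (ι ⊕ {v // v ∉ T}) = Fintype.card V - 1 := by
    have h₁ : Fintype.card {v // v ∉ T} = Fintype.card V - T.card := by
      rw [Fintype.card_subtype_compl, Fintype.card_coe]
    have h₂ := T.card_le_univ
    rw [Fintype.card_sum, h₁]
    omega
  rw [← hcard]
  refine hasPacking_card F ?_ ?_
  · rintro (i | v)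
    · refine ⟨fun x hx y hy => ?_, fun x hx => hST hx⟩
      have key : ∀ b : T, ReflTransGen (fun a b => c a b = i) ⟨x, hx⟩ b →
          ReflTransGen (F (Sum.inl i)).Adj x b := by
        intro b hb
        induction hb with
        | refl => exact .refl
        | @tail a b _ hab ih =>
          by_cases hne : a = b
          · exact hne ▸ ih
          · exact ih.tail ⟨fun h => hne (Subtype.ext h), a.2, b.2, hab⟩
      exact key ⟨y, hy⟩ (hc i _ _)
    · -- a star is strong because its centre and its leaves are joined by opposite arcs
      have hto : ∀ x ∈ (F (Sum.inr v)).verts, ReflTransGen (F (Sum.inr v)).Adj x v := by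
        rintro x (rfl | hx)
        exacts [.refl, .single (Or.inr ⟨hx, rfl⟩)]
      have hfrom : ∀ x ∈ (F (Sum.inr v)).verts, ReflTransGen (F (Sum.inr v)).Adj v x := by
        rintro x (rfl | hx)
        exacts [.refl, .single (Or.inl ⟨rfl, hx⟩)]
      exact ⟨fun x hx y hy => (hto x hx).trans (hfrom y hy), fun x hx => Or.inr (hST hx)⟩
  · rintro (i | v) (j | w) hij x y ⟨h₁, h₂⟩
    · obtain ⟨-, hx, hy, rfl⟩ := h₁
      obtain ⟨-, _, _, h⟩ := h₂
      exact hij (congrArg Sum.inl h)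
    · obtain ⟨-, hx, hy, -⟩ := h₁
      rcases h₂ with ⟨rfl, -⟩ | ⟨-, rfl⟩
      exacts [w.2 hx, w.2 hy]
    · obtain ⟨-, hx, hy, -⟩ := h₂
      rcases h₁ with ⟨rfl, -⟩ | ⟨-, rfl⟩
      exacts [v.2 hx, v.2 hy]
    · have hne : v.1 ≠ w.1 := fun h => hij (congrArg Sum.inr (Subtype.ext h))
      rcases h₁ with ⟨rfl, hy⟩ | ⟨hx, rfl⟩ <;> rcases h₂ with ⟨h, hy'⟩ | ⟨hx', h⟩
      exacts [hne h, v.2 hx', v.2 hy', hne h]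

/-! ### The zigzag colouring of the complete digraph on `ℤ/2h` -/

section Zigzag

variable {h : ℕ}

/-- The Hamiltonian path `i, i+1, i-1, i+2, i-2, …, i+h` of `ℤ/2h` uses one arc of each nonzero
difference, so its `2h` translates partition the arcs. `zigzag h x y` is the starting point `i` of
the translate that contains the arc `x y`; it is read off from the difference `y - x`, which is
`2j+1` on the arc from `i-j` to `i+j+1` and `2h-2j` on the arc from `i+j` to `i-j`. -/
def zigzag (h : ℕ) (x y : ZMod (2 * h)) : ZMod (2 * h) :=
  if (y - x).val % 2 = 1 then x + ((y - x).val / 2 : ℕ) else x + ((y - x).val / 2 : ℕ) - h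

theorem two_mul_natCast_self : (2 * h : ZMod (2 * h)) = 0 := by
  exact_mod_cast ZMod.natCast_self (2 * h)

theorem val_sub_eq {x y : ZMod (2 * h)} {d : ℕ} (hd : d < 2 * h) (hxy : y - x = d) :
    (y - x).val = d := by
  rw [hxy, ZMod.val_natCast_of_lt hd]

theorem zigzag_up (i : ZMod (2 * h)) {j : ℕ} (hj : j < h) :
    zigzag h (i - j) (i + j + 1) = i := by
  have hv : ((i + j + 1) - (i - j)).val = 2 * j + 1 :=
    val_sub_eq (by omega) (by push_cast; ring)
  rw [zigzag, hv, if_pos (by omega), show (2 * j + 1) / 2 = j by omega]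
  ring

theorem val_down (i : ZMod (2 * h)) {j : ℕ} (hj₁ : j + 1 < h) :
    ((i - (j + 1 : ℕ)) - (i + j + 1)).val = 2 * (h - (j + 1)) := by
  refine val_sub_eq (by omega) ?_
  have := two_mul_natCast_self (h := h)
  rw [Nat.cast_mul, Nat.cast_sub hj₁.le]
  push_cast
  linear_combination -this

theorem zigzag_down (i : ZMod (2 * h)) {j : ℕ} (hj₁ : j + 1 < h) :
    zigzag h (i + j + 1) (i - (j + 1 : ℕ)) = i := by
  rw [zigzag, val_down i hj₁, if_neg (by omega), Nat.mul_div_cancel_left _ two_pos,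
    Nat.cast_sub hj₁.le]
  push_cast
  ring

/-- Integers whose distance is positive and less than `2h` are distinct modulo `2h`. -/
theorem intCast_ne {a b : ℤ} (hab : a ≠ b) (h₁ : a - b < 2 * h) (h₂ : b - a < 2 * h) :
    (a : ZMod (2 * h)) ≠ b := by
  intro hc
  rw [ZMod.intCast_eq_intCast_iff_dvd_sub] at hc
  obtain ⟨c, hc⟩ := hc
  push_cast at hc
  rcases lt_trichotomy c 0 with hc0 | rfl | hc0
  · nlinarith
  · omega
  · nlinarith

/-- Every vertex lies on the zigzag path starting at `i`. -/
theorem exists_eq_zigzag (hh : 0 < h) (i x : ZMod (2 * h)) :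
    ∃ j < h, x = i - (j : ℕ) ∨ x = i + (j : ℕ) + 1 := by
  have : NeZero (2 * h) := ⟨by omega⟩
  have hlt := (x - i).val_lt
  have hv : ((x - i).val : ZMod (2 * h)) = x - i := ZMod.natCast_rightInverse _
  generalize (x - i).val = m at hlt hv
  have h2 := two_mul_natCast_self (h := h)
  rcases Nat.eq_zero_or_pos m with rfl | hm
  · exact ⟨0, hh, Or.inl (by linear_combination -hv)⟩
  rcases le_or_gt m h with hmh | hmh
  · refine ⟨m - 1, by omega, Or.inr ?_⟩
    rw [Nat.cast_sub hm]
    push_cast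
    linear_combination -hv
  · refine ⟨2 * h - m, by omega, Or.inl ?_⟩
    rw [Nat.cast_sub hlt.le]
    push_cast
    linear_combination -hv + h2

end Zigzag

/-! ### Strongness through closed walks -/

section Reach

variable {V : Type*} {R : V → V → Prop}

theorem reflTransGen_sequence {u : ℕ → V} {a b : ℕ} (hab : a ≤ b)
    (hu : ∀ j, a ≤ j → j < b → R (u j) (u (j + 1))) : ReflTransGen R (u a) (u b) := by
  induction b, hab using Nat.le_induction with
  | base => exact .refl
  | succ b hab ih => exact (ih fun j h₁ h₂ => hu j h₁ (by omega)).tail (hu b hab (by omega))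

/-- The walk `u a, v a, u (a+1), v (a+1), …, u b`. -/
theorem reflTransGen_alternating {u v : ℕ → V} {a b : ℕ} (hab : a ≤ b)
    (huv : ∀ j, a ≤ j → j < b → R (u j) (v j))
    (hvu : ∀ j, a ≤ j → j < b → R (v j) (u (j + 1))) : ReflTransGen R (u a) (u b) := by
  induction b, hab using Nat.le_induction with
  | base => exact .refl
  | succ b hab ih =>
    exact ((ih (fun j h₁ h₂ => huv j h₁ (by omega)) fun j h₁ h₂ => hvu j h₁ (by omega)).tail
      (huv b hab (by omega))).tail (hvu b hab (by omega))

/-- A vertex `x` lies on a walk from `a` to `b`. -/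
def OnWalk (R : V → V → Prop) (a b x : V) : Prop :=
  ReflTransGen R a x ∧ ReflTransGen R x b

theorem OnWalk.extend {a b a' b' x : V} (hx : OnWalk R a b x) (ha : ReflTransGen R a' a)
    (hb : ReflTransGen R b b') : OnWalk R a' b' x :=
  ⟨ha.trans hx.1, hx.2.trans hb⟩

theorem onWalk_alternating {u v : ℕ → V} {a b j : ℕ} (haj : a ≤ j) (hjb : j ≤ b)
    (huv : ∀ j, a ≤ j → j < b → R (u j) (v j))
    (hvu : ∀ j, a ≤ j → j < b → R (v j) (u (j + 1))) : OnWalk R (u a) (u b) (u j) :=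
  ⟨reflTransGen_alternating haj (fun i h₁ h₂ => huv i h₁ (by omega))
      fun i h₁ h₂ => hvu i h₁ (by omega),
    reflTransGen_alternating hjb (fun i h₁ h₂ => huv i (by omega) h₂)
      fun i h₁ h₂ => hvu i (by omega) h₂⟩

/-- If all vertices lie on closed walks through one vertex, the relation is strong. -/
theorem reflTransGen_of_onWalk {r : V} (hr : ∀ x, OnWalk R r r x) (x y : V) :
    ReflTransGen R x y :=
  (hr x).2.trans (hr y).1

end Reach

/-! ### Colourings of odd order -/

/-- The colouring for odd order, on `ℤ/2h` and a point `∞ = none`: every zigzag path is closed up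
through `∞`. -/
def oddColour (h : ℕ) : Option (ZMod (2 * h)) → Option (ZMod (2 * h)) → ZMod (2 * h)
  | none, none => 0
  | none, some y => y
  | some x, none => x - h
  | some x, some y => zigzag h x y

theorem strongColouring_odd {h : ℕ} (hh : 0 < h) :
    StrongColouring (Option (ZMod (2 * h))) (ZMod (2 * h)) := by
  have h2 := two_mul_natCast_self (h := h)
  refine ⟨oddColour h, fun i => ?_⟩
  let R := fun a b => oddColour h a b = i
  let u : ℕ → Option (ZMod (2 * h)) := fun j => some (i - j)
  let v : ℕ → Option (ZMod (2 * h)) := fun j => some (i + j + 1)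
  have huv : ∀ j < h, R (u j) (v j) := fun j hj => zigzag_up i hj
  have hvu : ∀ j, j + 1 < h → R (v j) (u (j + 1)) := fun j hj => zigzag_down i hj
  have hstart : ReflTransGen R none (u 0) := .single (by simp [R, u, oddColour])
  have hend : ReflTransGen R (u (h - 1)) none := by
    refine .head (huv _ (by omega)) (.single ?_)
    simp only [R, v, oddColour]
    rw [Nat.cast_sub hh]
    push_cast
    ring
  refine reflTransGen_of_onWalk (r := none) ?_
  have hall : ∀ j < h, OnWalk R none none (u j) := fun j hj =>
    (onWalk_alternating (Nat.zero_le j) (by omega : j ≤ h - 1) (fun j _ hj => huv j (by omega))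
      (fun j _ hj => hvu j (by omega))).extend hstart hend
  rintro (_ | x)
  · exact ⟨.refl, .refl⟩
  obtain ⟨j, hj, rfl | rfl⟩ := exists_eq_zigzag hh i x
  · exact hall j hj
  · refine ⟨(hall j hj).1.tail (huv j hj), ?_⟩
    by_cases hj' : j + 1 < h
    · exact (hall (j + 1) hj').2.head (hvu j hj')
    · obtain rfl : j = h - 1 := by omega
      refine .single ?_
      simp only [oddColour]
      rw [Nat.cast_sub hh]
      push_cast
      ring

/-! ### Colourings of even order -/

section Even

variable {h : ℕ}

/-- The colouring for even order `2h+2`, on `ℤ/2h` and two further points `∞₁ = none` and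
`∞₂ = some none`; the colours are `some i` for `i : ℤ/2h`, and `none`.

It modifies the following colouring. Colour `i` is given to the Hamiltonian cycle
`∞₁, i, ∞₂, i+1, i-1, i+2, i-2, …, i+h`, the zigzag path from `i` closed up through `∞₁` with its
first arc subdivided by `∞₂`; colour `none` is left with the cycle of all arcs from `x` to `x+1` and
the `2`-cycle on `∞₁, ∞₂`. To connect the latter two, fourteen arcs of colours `none`, `-1`, `0` and
`h` are exchanged among these colours. Their new colours are
* `none`: `∞₁ → -1`, `-2 → 1`, `∞₂ → h+1`, `h → ∞₁`, `0 → ∞₂`;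
* `-1`: `∞₁ → ∞₂`, `-2 → -1`, `-1 → 1`;
* `0`: `∞₂ → ∞₁`, `h → ∞₂`, `0 → 1`;
* `h`: `-1 → ∞₂`, `∞₂ → 1`, `h → h+1`.

For `h ≥ 3` all four classes become Hamiltonian cycles. -/
def evenColour (h : ℕ) :
    Option (Option (ZMod (2 * h))) → Option (Option (ZMod (2 * h))) → Option (ZMod (2 * h))
  | none, none => none
  | none, some none => some (-1)
  | some none, none => some 0
  | some none, some none => none
  | none, some (some y) => if y = -1 then none else some y
  | some (some x), none => if x = h then none else some (x - h)
  | some (some x), some none =>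
    if x = 0 then none else if x = h then some 0 else if x = -1 then some h else some x
  | some none, some (some y) =>
    if y = h + 1 then none else if y = 1 then some h else some (y - 1)
  | some (some x), some (some y) =>
    if x = -2 ∧ y = 1 then none
    else if x = -1 ∧ y = 1 then some (-1)
    else if y = x + 1 then
      if x = -2 then some (-1) else if x = 0 then some 0 else if x = h then some h else none
    else some (zigzag h x y)

theorem ne_add_one_of_val_ne (hh : 3 ≤ h) {x y : ZMod (2 * h)} (hxy : (y - x).val ≠ 1) :
    y ≠ x + 1 := by
  rintro rfl
  exact hxy (val_sub_eq (by omega) (by push_cast; ring))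

/-- Away from the recoloured arcs, the arcs of difference other than `1` keep their zigzag colour. -/
theorem evenColour_eq_zigzag (hh : 3 ≤ h) {x y i : ZMod (2 * h)} (hi : zigzag h x y = i)
    (hxy : (y - x).val ≠ 1) (h₁ : i = -1 → ¬(x = -2 ∧ y = 1)) (h₂ : i = h → ¬(x = -1 ∧ y = 1)) :
    evenColour h (some (some x)) (some (some y)) = some i := by
  have e₁ : zigzag h (-2) 1 = -1 := by
    convert zigzag_up (-1 : ZMod (2 * h)) (j := 1) (by omega) using 2 <;> push_cast <;> ring
  have e₂ : zigzag h (-1) 1 = h := by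
    have h2 := two_mul_natCast_self (h := h)
    have hc : ((h - 2 : ℕ) : ZMod (2 * h)) = h - 2 := by
      rw [Nat.cast_sub (by omega)]
      norm_cast
    convert zigzag_down (h : ZMod (2 * h)) (j := h - 2) (by omega) using 2
    · linear_combination -h2 - hc
    · push_cast
      linear_combination hc
  have n₁ : ¬(x = -2 ∧ y = 1) := by
    rintro ⟨rfl, rfl⟩
    exact h₁ (hi ▸ e₁) ⟨rfl, rfl⟩
  have n₂ : ¬(x = -1 ∧ y = 1) := by
    rintro ⟨rfl, rfl⟩
    exact h₂ (hi ▸ e₂) ⟨rfl, rfl⟩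
  simp only [evenColour]
  rw [if_neg n₁, if_neg n₂, if_neg (ne_add_one_of_val_ne hh hxy), hi]

theorem evenColour_up (hh : 3 ≤ h) (i : ZMod (2 * h)) {j : ℕ} (h1 : 1 ≤ j) (hj : j < h)
    (hij : i = -1 → j ≠ 1) :
    evenColour h (some (some (i - j))) (some (some (i + j + 1))) = some i := by
  have hv : ((i + j + 1) - (i - j)).val = 2 * j + 1 :=
    val_sub_eq (by omega) (by push_cast; ring)
  refine evenColour_eq_zigzag hh (zigzag_up i hj) (by omega) ?_ ?_
  · rintro rfl ⟨hx, -⟩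
    have hne := intCast_ne (h := h) (a := -1 - j) (b := -2) (by have := hij rfl; omega) (by omega)
      (by omega)
    push_cast at hne
    exact hne hx
  · rintro rfl ⟨hx, -⟩
    have hne := intCast_ne (h := h) (a := h - j) (b := -1) (by omega) (by omega) (by omega)
    push_cast at hne
    exact hne hx

theorem evenColour_down (hh : 3 ≤ h) (i : ZMod (2 * h)) {j : ℕ} (hj : j + 1 < h)
    (hij : i = h → j + 2 ≠ h) :
    evenColour h (some (some (i + j + 1))) (some (some (i - (j + 1 : ℕ)))) = some i := by
  have hv := val_down i hj
  refine evenColour_eq_zigzag hh (zigzag_down i hj) (by omega) ?_ ?_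
  · rintro rfl ⟨hx, -⟩
    have hne := intCast_ne (h := h) (a := -1 + j + 1) (b := -2) (by omega) (by omega) (by omega)
    push_cast at hne
    exact hne hx
  · rintro rfl ⟨-, hx⟩
    have hne := intCast_ne (h := h) (a := h - (j + 1)) (b := 1) (by have := hij rfl; omega)
      (by omega) (by omega)
    push_cast at hne hx
    exact hne hx

/-- The arcs of difference `1` that keep the colour `none`. -/
theorem evenColour_succ (hh : 3 ≤ h) {j : ℕ} (hj : 1 ≤ j ∧ j < h ∨ h < j ∧ j < 2 * h - 2) :
    evenColour h (some (some (j : ZMod (2 * h)))) (some (some ((j + 1 : ℕ) : ZMod (2 * h))))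
      = none := by
  have n₁ := intCast_ne (h := h) (a := j) (b := -2) (by omega) (by omega) (by omega)
  have n₂ := intCast_ne (h := h) (a := j) (b := -1) (by omega) (by omega) (by omega)
  have n₃ := intCast_ne (h := h) (a := j) (b := 0) (by omega) (by omega) (by omega)
  have n₄ := intCast_ne (h := h) (a := j) (b := h) (by omega) (by omega) (by omega)
  push_cast at n₁ n₂ n₃ n₄
  simp [evenColour, n₁, n₂, n₃, n₄]

/-- Colour `none`: `∞₁, -1, 0, ∞₂, h+1, h+2, …, -2, 1, 2, …, h`. -/
theorem evenColour_none_strong (hh : 3 ≤ h) (x y) :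
    ReflTransGen (fun a b => evenColour h a b = none) x y := by
  let R := fun a b => evenColour h a b = none
  have : NeZero (2 * h) := ⟨by omega⟩
  let u : ℕ → Option (Option (ZMod (2 * h))) := fun j => some (some j)
  have h2 := two_mul_natCast_self (h := h)
  have n₁ := intCast_ne (h := h) (a := -1) (b := -2) (by omega) (by omega) (by omega)
  have n₂ := intCast_ne (h := h) (a := 0) (b := 1) (by omega) (by omega) (by omega)
  have n₃ := intCast_ne (h := h) (a := -1) (b := 0) (by omega) (by omega) (by omega)
  have n₄ := intCast_ne (h := h) (a := -1) (b := h) (by omega) (by omega) (by omega)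
  push_cast at n₁ n₂ n₃ n₄
  have a₁ : R none (some (some (-1))) := by simp [R, evenColour]
  have a₂ : R (some (some (-1))) (some (some 0)) := by
    simp [R, evenColour, n₁, n₂, n₃, n₄]
  have a₃ : R (some (some 0)) (some none) := by simp [R, evenColour]
  have a₄ : R (some none) (u (h + 1)) := by simp [R, u, evenColour]
  have a₅ : R (u (2 * h - 2)) (u 1) := by
    have : ((2 * h - 2 : ℕ) : ZMod (2 * h)) = -2 := by
      rw [Nat.cast_sub (by omega)]
      push_cast
      linear_combination h2
    simp [R, u, evenColour, this]
  have a₆ : R (u h) none := by simp [R, u, evenColour]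
  have s₁ : ∀ {a b}, h + 1 ≤ a → a ≤ b → b ≤ 2 * h - 2 → ReflTransGen R (u a) (u b) :=
    fun ha hab hb => reflTransGen_sequence hab fun j _ _ => evenColour_succ hh (by omega)
  have s₂ : ∀ {a b}, 1 ≤ a → a ≤ b → b ≤ h → ReflTransGen R (u a) (u b) :=
    fun ha hab hb => reflTransGen_sequence hab fun j _ _ => evenColour_succ hh (by omega)
  have w₁ : ReflTransGen R none (some (some (-1))) := .single a₁
  have w₂ := w₁.tail a₂
  have w₃ := w₂.tail a₃
  have w₄ := w₃.tail a₄
  have w₅ := (w₄.trans (s₁ le_rfl (by omega) le_rfl)).tail a₅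
  have z₂ : ReflTransGen R (u 1) none := (s₂ le_rfl (by omega) le_rfl).tail a₆
  have z₄ := (s₁ le_rfl (by omega) le_rfl).trans (z₂.head a₅)
  have z₅ := z₄.head a₄
  have z₆ := z₅.head a₃
  refine reflTransGen_of_onWalk (r := none) ?_ x y
  rintro (_ | _ | x)
  · exact ⟨.refl, .refl⟩
  · exact ⟨w₃, z₅⟩
  obtain ⟨m, hm, rfl⟩ : ∃ m < 2 * h, (m : ZMod (2 * h)) = x :=
    ⟨x.val, x.val_lt, ZMod.natCast_rightInverse x⟩
  rcases Nat.eq_zero_or_pos m with rfl | hm0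
  · simpa [OnWalk] using And.intro w₂ z₆
  rcases le_or_gt m h with hmh | hmh
  · exact ⟨w₅.trans (s₂ le_rfl hm0 hmh), (s₂ hm0 hmh le_rfl).tail a₆⟩
  rcases eq_or_ne m (2 * h - 1) with rfl | hmne
  · have : ((2 * h - 1 : ℕ) : ZMod (2 * h)) = -1 := by
      rw [Nat.cast_sub (by omega)]
      push_cast
      linear_combination h2
    rw [this]
    exact ⟨w₁, z₆.head a₂⟩
  · exact ⟨w₄.trans (s₁ le_rfl (by omega) (by omega)),
      (s₁ (by omega) (by omega) le_rfl).trans (z₂.head a₅)⟩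

theorem natCast_pred_add (i : ZMod (2 * h)) (hh : 0 < h) :
    i + ((h - 1 : ℕ) : ZMod (2 * h)) + 1 = i + h := by
  rw [Nat.cast_sub hh]
  push_cast
  ring

/-- Colour `i ≠ -1, 0, h`: `∞₁, i, ∞₂, i+1, i-1, i+2, …, i+h`. -/
theorem evenColour_some_strong (hh : 3 ≤ h) {i : ZMod (2 * h)} (i₁ : i ≠ -1) (i₂ : i ≠ 0)
    (i₃ : i ≠ h) (x y) : ReflTransGen (fun a b => evenColour h a b = some i) x y := by
  let R := fun a b => evenColour h a b = some i
  let u : ℕ → Option (Option (ZMod (2 * h))) := fun j => some (some (i - j))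
  let v : ℕ → Option (Option (ZMod (2 * h))) := fun j => some (some (i + j + 1))
  have huv : ∀ j, 1 ≤ j → j < h → R (u j) (v j) := fun j h₁ h₂ =>
    evenColour_up hh i h₁ h₂ fun h => absurd h i₁
  have hvu : ∀ j, j + 1 < h → R (v j) (u (j + 1)) := fun j hj =>
    evenColour_down hh i hj fun h => absurd h i₃
  have a₁ : R none (u 0) := by simp [R, u, evenColour, i₁]
  have a₂ : R (u 0) (some none) := by simp [R, u, evenColour, i₁, i₂, i₃]
  have a₃ : R (some none) (v 0) := by simp [R, v, evenColour, i₂, i₃]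
  have a₄ : R (v (h - 1)) none := by
    simp only [R, v, natCast_pred_add i (by omega : 0 < h)]
    simp [evenColour, i₂]
  have s : ∀ {a b}, 1 ≤ a → a ≤ b → b < h → ReflTransGen R (u a) (u b) := fun ha hab hb =>
    reflTransGen_alternating hab (fun j _ _ => huv j (by omega) (by omega))
      fun j _ _ => hvu j (by omega)
  have w₁ : ReflTransGen R none (u 0) := .single a₁
  have w₂ := w₁.tail a₂
  have w₃ := w₂.tail a₃
  have w₄ := w₃.tail (hvu 0 (by omega))
  have z₁ : ReflTransGen R (v (h - 1)) none := .single a₄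
  have z₂ := z₁.head (huv (h - 1) (by omega) (by omega))
  have z₃ := (s le_rfl (by omega : 1 ≤ h - 1) (by omega)).trans z₂
  have z₄ := z₃.head (hvu 0 (by omega))
  have z₅ := z₄.head a₃
  refine reflTransGen_of_onWalk (r := none) ?_ x y
  have hu : ∀ j, 1 ≤ j → j < h → OnWalk R none none (u j) := fun j h₁ h₂ =>
    ⟨w₄.trans (s le_rfl h₁ h₂), (s h₁ (by omega : j ≤ h - 1) (by omega)).trans z₂⟩
  rintro (_ | _ | x)
  · exact ⟨.refl, .refl⟩
  · exact ⟨w₂, z₅⟩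
  obtain ⟨j, hj, rfl | rfl⟩ := exists_eq_zigzag (by omega) i x
  · rcases Nat.eq_zero_or_pos j with rfl | hj0
    · exact ⟨w₁, z₅.head a₂⟩
    · exact hu j hj0 hj
  · rcases Nat.eq_zero_or_pos j with rfl | hj0
    · exact ⟨w₃, z₄⟩
    refine ⟨(hu j hj0 hj).1.tail (huv j hj0 hj), ?_⟩
    rcases eq_or_ne j (h - 1) with rfl | hj'
    · exact z₁
    · exact (hu (j + 1) (by omega) (by omega)).2.head (hvu j (by omega))

/-- Colour `0`: `∞₁, 0, 1, -1, 2, -2, …, h, ∞₂`. -/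
theorem evenColour_zero_strong (hh : 3 ≤ h) (x y) :
    ReflTransGen (fun a b => evenColour h a b = some 0) x y := by
  let R := fun a b => evenColour h a b = some 0
  let u : ℕ → Option (Option (ZMod (2 * h))) := fun j => some (some (0 - j))
  let v : ℕ → Option (Option (ZMod (2 * h))) := fun j => some (some (0 + j + 1))
  have n₁ := intCast_ne (h := h) (a := 0) (b := -1) (by omega) (by omega) (by omega)
  have n₂ := intCast_ne (h := h) (a := 0) (b := h) (by omega) (by omega) (by omega)
  have n₃ := intCast_ne (h := h) (a := 0) (b := -2) (by omega) (by omega) (by omega)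
  push_cast at n₁ n₂ n₃
  have huv : ∀ j, j < h → R (u j) (v j) := fun j h₂ => by
    rcases Nat.eq_zero_or_pos j with rfl | hj
    · simp [R, u, v, evenColour, n₁, n₃]
    · exact evenColour_up hh 0 hj h₂ fun h => absurd h n₁
  have hvu : ∀ j, j + 1 < h → R (v j) (u (j + 1)) := fun j hj =>
    evenColour_down hh 0 hj fun h => absurd h n₂
  have a₁ : R none (u 0) := by simp [R, u, evenColour, n₁]
  have a₂ : R (v (h - 1)) (some none) := by
    simp only [R, v, natCast_pred_add 0 (by omega : 0 < h)]
    simp [evenColour, n₂.symm]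
  have a₃ : R (some none) none := by simp [R, evenColour]
  have s : ∀ {a b}, a ≤ b → b < h → ReflTransGen R (u a) (u b) := fun hab hb =>
    reflTransGen_alternating hab (fun j _ _ => huv j (by omega)) fun j _ _ => hvu j (by omega)
  have z₀ : ReflTransGen R (some none) none := .single a₃
  have z₁ := z₀.head a₂
  have z₂ := z₁.head (huv (h - 1) (by omega))
  have w₀ : ReflTransGen R none (u 0) := .single a₁
  have hu : ∀ j < h, OnWalk R none none (u j) := fun j hj =>
    ⟨w₀.trans (s (Nat.zero_le _) hj), (s (by omega : j ≤ h - 1) (by omega)).trans z₂⟩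
  refine reflTransGen_of_onWalk (r := none) ?_ x y
  rintro (_ | _ | x)
  · exact ⟨.refl, .refl⟩
  · exact ⟨((hu (h - 1) (by omega)).1.tail (huv _ (by omega))).tail a₂, z₀⟩
  obtain ⟨j, hj, rfl | rfl⟩ := exists_eq_zigzag (by omega) 0 x
  · exact hu j hj
  · refine ⟨(hu j hj).1.tail (huv j hj), ?_⟩
    rcases eq_or_ne j (h - 1) with rfl | hj'
    · exact z₁
    · exact (hu (j + 1) (by omega)).2.head (hvu j (by omega))

/-- Colour `-1`: `∞₁, ∞₂, 0, -2, -1, 1, -3, 2, …, h-1`. -/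
theorem evenColour_neg_one_strong (hh : 3 ≤ h) (x y) :
    ReflTransGen (fun a b => evenColour h a b = some (-1)) x y := by
  let R := fun a b => evenColour h a b = some (-1)
  let u : ℕ → Option (Option (ZMod (2 * h))) := fun j => some (some (-1 - j))
  let v : ℕ → Option (Option (ZMod (2 * h))) := fun j => some (some (-1 + j + 1))
  have n₁ := intCast_ne (h := h) (a := 0) (b := 1) (by omega) (by omega) (by omega)
  have n₂ := intCast_ne (h := h) (a := 0) (b := h + 1) (by omega) (by omega) (by omega)
  have n₃ := intCast_ne (h := h) (a := -1) (b := 1) (by omega) (by omega) (by omega)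
  have n₄ := intCast_ne (h := h) (a := -1) (b := -2) (by omega) (by omega) (by omega)
  have n₅ := intCast_ne (h := h) (a := -1) (b := h) (by omega) (by omega) (by omega)
  push_cast at n₁ n₂ n₃ n₄ n₅
  have huv : ∀ j, 2 ≤ j → j < h → R (u j) (v j) := fun j h₁ h₂ =>
    evenColour_up hh (-1) (by omega) h₂ fun _ => by omega
  have hvu : ∀ j, j + 1 < h → R (v j) (u (j + 1)) := fun j hj =>
    evenColour_down hh (-1) hj fun h => absurd h n₅
  have a₁ : R none (some none) := by simp [R, evenColour]
  have a₂ : R (some none) (v 0) := by simp [R, v, evenColour, n₁, n₂]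
  have a₃ : R (u 1) (u 0) := by
    have e : (-1 - 1 : ZMod (2 * h)) = -2 := by ring
    have e' : (-2 + 1 : ZMod (2 * h)) = -1 := by ring
    simp [R, u, evenColour, n₃, e, e']
  have a₄ : R (u 0) (v 1) := by simp [R, u, v, evenColour, n₄]
  have a₅ : R (v (h - 1)) none := by
    simp only [R, v, natCast_pred_add (-1) (by omega : 0 < h)]
    simp [evenColour, n₁.symm]
  have s : ∀ {a b}, 2 ≤ a → a ≤ b → b < h → ReflTransGen R (u a) (u b) := fun ha hab hb =>
    reflTransGen_alternating hab (fun j _ _ => huv j (by omega) (by omega))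
      fun j _ _ => hvu j (by omega)
  have w₀ : ReflTransGen R none (some none) := .single a₁
  have w₁ := w₀.tail a₂
  have w₂ := w₁.tail (hvu 0 (by omega))
  have w₃ := w₂.tail a₃
  have w₄ := w₃.tail a₄
  have w₅ := w₄.tail (hvu 1 (by omega))
  have z₀ : ReflTransGen R (v (h - 1)) none := .single a₅
  have z₁ := z₀.head (huv (h - 1) (by omega) (by omega))
  have z₂ := (s le_rfl (by omega : 2 ≤ h - 1) (by omega)).trans z₁
  have z₃ := z₂.head (hvu 1 (by omega))
  have z₄ := z₃.head a₄
  have z₅ := z₄.head a₃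
  have z₆ := z₅.head (hvu 0 (by omega))
  have hu : ∀ j, 2 ≤ j → j < h → OnWalk R none none (u j) := fun j h₁ h₂ =>
    ⟨w₅.trans (s le_rfl h₁ h₂), (s h₁ (by omega : j ≤ h - 1) (by omega)).trans z₁⟩
  refine reflTransGen_of_onWalk (r := none) ?_ x y
  rintro (_ | _ | x)
  · exact ⟨.refl, .refl⟩
  · exact ⟨w₀, z₆.head a₂⟩
  obtain ⟨j, hj, rfl | rfl⟩ := exists_eq_zigzag (by omega) (-1) x
  · match j, hj with
    | 0, _ => exact ⟨w₃, z₄⟩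
    | 1, _ => exact ⟨w₂, z₅⟩
    | j + 2, hj => exact hu _ (by omega) hj
  · match j, hj with
    | 0, _ => exact ⟨w₁, z₆⟩
    | 1, _ => exact ⟨w₄, z₃⟩
    | j + 2, hj =>
      refine ⟨(hu _ (by omega) hj).1.tail (huv _ (by omega) hj), ?_⟩
      rcases eq_or_ne (j + 2) (h - 1) with hj' | hj'
      · exact hj' ▸ z₀
      · exact (hu (j + 3) (by omega) (by omega)).2.head (hvu _ (by omega))

/-- Colour `h`: `∞₁, h, h+1, h-1, h+2, …, 2, -1, ∞₂, 1, 0`. -/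
theorem evenColour_half_strong (hh : 3 ≤ h) (x y) :
    ReflTransGen (fun a b => evenColour h a b = some (h : ZMod (2 * h))) x y := by
  let R := fun a b => evenColour h a b = some (h : ZMod (2 * h))
  let u : ℕ → Option (Option (ZMod (2 * h))) := fun j => some (some (h - j))
  let v : ℕ → Option (Option (ZMod (2 * h))) := fun j => some (some (h + j + 1))
  have h2 := two_mul_natCast_self (h := h)
  have n₁ := intCast_ne (h := h) (a := h) (b := -1) (by omega) (by omega) (by omega)
  have n₂ := intCast_ne (h := h) (a := h) (b := -2) (by omega) (by omega) (by omega)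
  have n₃ := intCast_ne (h := h) (a := h) (b := 0) (by omega) (by omega) (by omega)
  have n₄ := intCast_ne (h := h) (a := -1) (b := 0) (by omega) (by omega) (by omega)
  push_cast at n₁ n₂ n₃ n₄
  have huv : ∀ j, j < h → R (u j) (v j) := fun j h₂ => by
    rcases Nat.eq_zero_or_pos j with rfl | hj
    · simp [R, u, v, evenColour, n₁, n₂, n₃]
    · exact evenColour_up hh h hj h₂ fun h => absurd h n₁
  have hvu : ∀ j, j + 2 < h → R (v j) (u (j + 1)) := fun j hj =>
    evenColour_down hh h (by omega) fun _ => by omega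
  have a₁ : R none (u 0) := by simp [R, u, evenColour, n₁]
  have e₁ : (h + (h - 2 : ℕ) + 1 : ZMod (2 * h)) = -1 := by
    rw [Nat.cast_sub (by omega)]
    push_cast
    linear_combination h2
  have e₂ : (h - (h - 1 : ℕ) : ZMod (2 * h)) = 1 := by
    rw [Nat.cast_sub (by omega)]
    push_cast
    ring
  have e₃ : (h + (h - 1 : ℕ) + 1 : ZMod (2 * h)) = 0 := by
    rw [Nat.cast_sub (by omega)]
    push_cast
    linear_combination h2
  have a₂ : R (v (h - 2)) (some none) := by
    simp only [R, v, e₁]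
    simp [evenColour, n₁.symm, n₄]
  have a₃ : R (some none) (u (h - 1)) := by
    simp only [R, u, e₂]
    simp [evenColour, n₃]
  have a₄ : R (v (h - 1)) none := by
    simp only [R, v, e₃]
    simp only [evenColour, if_neg n₃.symm, Option.some.injEq]
    linear_combination -h2
  have s : ∀ {a b}, a ≤ b → b + 1 < h → ReflTransGen R (u a) (u b) := fun hab hb =>
    reflTransGen_alternating hab (fun j _ _ => huv j (by omega)) fun j _ _ => hvu j (by omega)
  have w₀ : ReflTransGen R none (u 0) := .single a₁
  have w₁ := w₀.trans (s (Nat.zero_le (h - 2)) (by omega))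
  have w₂ := w₁.tail (huv _ (by omega))
  have w₃ := w₂.tail a₂
  have w₄ := w₃.tail a₃
  have w₅ := w₄.tail (huv _ (by omega))
  have z₀ : ReflTransGen R (v (h - 1)) none := .single a₄
  have z₁ := z₀.head (huv _ (by omega))
  have z₂ := z₁.head a₃
  have z₃ := z₂.head a₂
  have z₄ := z₃.head (huv _ (by omega))
  have hu : ∀ j, j + 1 < h → OnWalk R none none (u j) := fun j hj =>
    ⟨w₀.trans (s (Nat.zero_le _) hj), (s (by omega : j ≤ h - 2) (by omega)).trans z₄⟩
  refine reflTransGen_of_onWalk (r := none) ?_ x y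
  rintro (_ | _ | x)
  · exact ⟨.refl, .refl⟩
  · exact ⟨w₃, z₂⟩
  obtain ⟨j, hj, rfl | rfl⟩ := exists_eq_zigzag (by omega) (h : ZMod (2 * h)) x
  · rcases eq_or_ne j (h - 1) with rfl | hj'
    · exact ⟨w₄, z₁⟩
    · exact hu j (by omega)
  · rcases eq_or_ne j (h - 1) with rfl | hj₁
    · exact ⟨w₅, z₀⟩
    rcases eq_or_ne j (h - 2) with rfl | hj₂
    · exact ⟨w₂, z₃⟩
    · exact ⟨(hu j (by omega)).1.tail (huv j hj), (hu (j + 1) (by omega)).2.head (hvu j (by omega))⟩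

theorem strongColouring_even (hh : 3 ≤ h) :
    StrongColouring (Option (Option (ZMod (2 * h)))) (Option (ZMod (2 * h))) := by
  refine ⟨evenColour h, ?_⟩
  rintro (_ | i)
  · exact evenColour_none_strong hh
  by_cases i₁ : i = -1
  · exact i₁ ▸ evenColour_neg_one_strong hh
  by_cases i₂ : i = 0
  · exact i₂ ▸ evenColour_zero_strong hh
  by_cases i₃ : i = h
  · exact i₃ ▸ evenColour_half_strong hh
  exact evenColour_some_strong hh i₁ i₂ i₃

end Even

theorem strongColouring_two : StrongColouring (Fin 2) Unit := by
  refine ⟨fun _ _ => (), fun i x y => .single rfl⟩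

/-- Complete digraphs of all orders except `4` and `6` have strong colourings with as many colours
as the out-degree. -/
theorem strongColouring_of_card {V ι : Type*} [Fintype V] [Fintype ι]
    (h2 : 2 ≤ Fintype.card V) (h4 : Fintype.card V ≠ 4) (h6 : Fintype.card V ≠ 6)
    (hι : Fintype.card ι + 1 = Fintype.card V) : StrongColouring V ι := by
  rcases Nat.even_or_odd' (Fintype.card V) with ⟨m, hm | hm⟩
  · rcases Nat.lt_or_ge m 2 with hm2 | hm2
    · exact strongColouring_two.congr
        (Fintype.equivOfCardEq (by rw [Fintype.card_fin]; omega))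
        (Fintype.equivOfCardEq (by rw [Fintype.card_unit]; omega))
    · have : NeZero (2 * (m - 1)) := ⟨by omega⟩
      exact (strongColouring_even (h := m - 1) (by omega)).congr
        (Fintype.equivOfCardEq (by simp only [Fintype.card_option, ZMod.card]; omega))
        (Fintype.equivOfCardEq (by simp only [Fintype.card_option, ZMod.card]; omega))
  · have : NeZero (2 * m) := ⟨by omega⟩
    exact (strongColouring_odd (h := m) (by omega)).congr
      (Fintype.equivOfCardEq (by simp only [Fintype.card_option, ZMod.card]; omega))
      (Fintype.equivOfCardEq (by simp only [ZMod.card]; omega))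

/-! ### Six and four vertices: no Hamiltonian decomposition -/

/-- The arcs of the closed walk `0, l₀, l₁, …, 0`, the arc `x y` being encoded as `n * x + y`. -/
def cycleArcs (n : ℕ) (l : List ℕ) : List ℕ :=
  List.zipWith (fun x y => n * x + y) (0 :: l) (l ++ [0])

/-- Exhaustive search for pairwise arc-disjoint Hamiltonian cycles on `{0, …, n - 1}` that avoid the
arcs in `used`, one beginning with the arc `0 f` for each `f` in the list. -/
def searchCycles (n : ℕ) : List ℕ → List ℕ → Bool
  | [], _ => true
  | f :: fs, used => (List.permutations' (List.range' 1 (n - 1))).any fun l =>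
      l.head? == some f && (cycleArcs n l).all (fun a => !used.elem a) &&
        searchCycles n fs (cycleArcs n l ++ used)

theorem searchCycles_four : searchCycles 4 [1, 2, 3] [] = false := by decide +kernel

theorem searchCycles_six : searchCycles 6 [1, 2, 3, 4, 5] [] = false := by decide +kernel

/-- A self-map of `Fin n` under which every point reaches every point is an `n`-cycle. -/
theorem minimalPeriod_eq {n : ℕ} [NeZero n] {s : Fin n → Fin n}
    (hs : ∀ x y, ∃ t, s^[t] x = y) : Function.minimalPeriod s 0 = n := by
  obtain ⟨t, ht⟩ := hs (s 0) 0
  have hper : Function.IsPeriodicPt s (t + 1) 0 := ht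
  have hpos : 0 < Function.minimalPeriod s 0 := hper.minimalPeriod_pos t.succ_pos
  refine le_antisymm ?_ ?_
  · have := Fintype.card_le_of_injective
      (fun k : Fin (Function.minimalPeriod s 0) => s^[k] 0) fun a b hab =>
        Fin.ext (Function.iterate_injOn_Iio_minimalPeriod a.2 b.2 hab)
    simpa using this
  · have := Fintype.card_le_of_surjective
      (fun k : Fin (Function.minimalPeriod s 0) => s^[k] 0) fun y => by
        obtain ⟨k, hk⟩ := hs 0 y
        exact ⟨⟨k % _, Nat.mod_lt _ hpos⟩, by rw [← hk]; exact Function.iterate_mod_minimalPeriod_eq⟩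
    simpa using this

/-- The list of vertices after `0` on the cycle of `s`. -/
def cycleList {m : ℕ} (s : Fin (m + 1) → Fin (m + 1)) : List ℕ :=
  (List.range m).map fun t => (s^[t + 1] 0 : Fin (m + 1)).val

theorem cycleList_mem {m : ℕ} {s : Fin (m + 1) → Fin (m + 1)} (hs : ∀ x y, ∃ t, s^[t] x = y) :
    cycleList s ∈ List.permutations' (List.range' 1 m) := by
  have hp := minimalPeriod_eq hs
  have hinj : ∀ a ≤ m, ∀ b ≤ m, s^[a] 0 = s^[b] 0 → a = b := fun a ha b hb hab =>
    Function.iterate_injOn_Iio_minimalPeriod (f := s) (x := 0) (Set.mem_Iio.2 (by omega))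
      (Set.mem_Iio.2 (by omega)) hab
  rw [List.mem_permutations']
  refine (List.subperm_of_subset ?_ ?_).perm_of_length_le (by simp [cycleList])
  · refine List.Nodup.map_on (fun a ha b hb hab => ?_) List.nodup_range
    rw [List.mem_range] at ha hb
    have := hinj _ (by omega) _ (by omega) (Fin.ext hab)
    omega
  · intro a ha
    obtain ⟨t, ht, rfl⟩ := List.mem_map.1 ha
    rw [List.mem_range] at ht
    have h0 : (s^[t + 1] 0).val ≠ 0 := fun h => by
      have := hinj (t + 1) (by omega) 0 (by omega) (Fin.ext h)
      omega
    rw [List.mem_range'_1]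
    omega

theorem exists_of_mem_cycleArcs {m : ℕ} {s : Fin (m + 1) → Fin (m + 1)}
    (hs : ∀ x y, ∃ t, s^[t] x = y) {a : ℕ} (ha : a ∈ cycleArcs (m + 1) (cycleList s)) :
    ∃ x : Fin (m + 1), a = (m + 1) * x + s x := by
  have hp := minimalPeriod_eq hs
  have h0 : s^[m + 1] 0 = 0 := by
    have := Function.iterate_minimalPeriod (f := s) (x := 0)
    rwa [hp] at this
  have e₁ : 0 :: cycleList s = (List.range (m + 1)).map fun t => (s^[t] 0).val := by
    rw [List.range_succ_eq_map, List.map_cons, List.map_map]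
    rfl
  have e₂ : cycleList s ++ [0] = (List.range (m + 1)).map fun t => (s^[t + 1] 0).val := by
    rw [List.range_succ, List.map_append, List.map_singleton, h0]
    rfl
  rw [cycleArcs, e₁, e₂, List.zipWith_map, List.zipWith_self] at ha
  obtain ⟨t, -, rfl⟩ := List.mem_map.1 ha
  exact ⟨s^[t] 0, by rw [Function.iterate_succ_apply']⟩

/-- The search succeeds if there are cycles `s f`, for `f` in the list, as required. -/
theorem searchCycles_eq_true {m : ℕ} (hm : 0 < m) (s : ℕ → Fin (m + 1) → Fin (m + 1)) :
    ∀ (fs used : List ℕ), fs.Nodup → (∀ f ∈ fs, ∀ x y, ∃ t, (s f)^[t] x = y) →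
      (∀ f ∈ fs, (s f 0).val = f) → (∀ f ∈ fs, ∀ g ∈ fs, f ≠ g → ∀ x, s f x ≠ s g x) →
      (∀ f ∈ fs, ∀ x : Fin (m + 1), (m + 1) * x.val + (s f x).val ∉ used) →
      searchCycles (m + 1) fs used = true
  | [], _ => fun _ _ _ _ _ => rfl
  | f :: fs, used => fun hnd hs h0 hdisj hused => by
    rw [List.nodup_cons] at hnd
    have hsf := hs f List.mem_cons_self
    rw [searchCycles, List.any_eq_true]
    refine ⟨cycleList (s f), cycleList_mem hsf, ?_⟩
    rw [Bool.and_eq_true, Bool.and_eq_true]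
    refine ⟨⟨?_, ?_⟩, ?_⟩
    · obtain ⟨m, rfl⟩ : ∃ k, m = k + 1 := ⟨m - 1, by omega⟩
      rw [cycleList, List.range_succ_eq_map]
      simp [h0 f List.mem_cons_self]
    · rw [List.all_eq_true]
      intro a ha
      obtain ⟨x, rfl⟩ := exists_of_mem_cycleArcs hsf ha
      simpa using hused f List.mem_cons_self x
    · refine searchCycles_eq_true hm s fs _ hnd.2 (fun g hg => hs g (List.mem_cons_of_mem _ hg))
        (fun g hg => h0 g (List.mem_cons_of_mem _ hg))
        (fun g hg g' hg' => hdisj g (List.mem_cons_of_mem _ hg) g' (List.mem_cons_of_mem _ hg'))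
        fun g hg x hx => ?_
      rcases List.mem_append.1 hx with hx | hx
      · obtain ⟨y, hy⟩ := exists_of_mem_cycleArcs hsf hx
        have hxy : x = y := by
          have h₁ := congrArg (· / (m + 1)) hy
          simpa [Nat.mul_add_div, Nat.div_eq_of_lt (s g x).isLt, Nat.div_eq_of_lt (s f y).isLt,
            Fin.ext_iff] using h₁
        subst hxy
        have hne : f ≠ g := fun h => hnd.1 (h ▸ hg)
        exact hdisj f List.mem_cons_self g (List.mem_cons_of_mem _ hg) hne x
          (Fin.ext (by omega))
      · exact hused g (List.mem_cons_of_mem _ hg) x hx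

theorem exists_iterate_eq {V : Type*} {R : V → V → Prop} {s : V → V}
    (hR : ∀ x y, R x y → y = s x) {x y : V} (h : ReflTransGen R x y) : ∃ t, s^[t] x = y := by
  induction h with
  | refl => exact ⟨0, rfl⟩
  | tail _ hyz ih =>
    obtain ⟨t, ht⟩ := ih
    exact ⟨t + 1, by rw [Function.iterate_succ_apply', ht, hR _ _ hyz]⟩

/-- A packing of `|V| - 1` spanning strong subgraphs of a loopless digraph uses exactly one arc of
each subgraph at each vertex, so it consists of Hamiltonian cycles. -/
theorem HasPacking.searchCycles {V : Type*} [Fintype V] {D : Digraph V} {m : ℕ} (hm : 0 < m)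
    (hV : Fintype.card V = m + 1) (hD : Loopless D) (h : HasPacking D Finset.univ m) :
    searchCycles (m + 1) (List.range' 1 m) [] = true := by
  classical
  obtain ⟨F, h₁, h₂⟩ := h
  have hcard : 2 ≤ (Finset.univ : Finset V).card := by rw [Finset.card_univ]; omega
  choose f hf using fun i v => (h₁ i).1.exists_adj (h₁ i).2 hcard (Finset.mem_univ v)
  have hdisj : ∀ i j x, f i x = f j x → i = j := fun i j x hij => by
    by_contra hne
    exact h₂ i j hne x (f i x) ⟨hf i x, hij ▸ hf j x⟩
  have hbij : ∀ v, Function.Bijective fun i : Fin m =>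
      (⟨f i v, hD.ne ((F i).adj_sub (hf i v))⟩ : {w // w ≠ v}) := fun v => by
    rw [Fintype.bijective_iff_injective_and_card]
    exact ⟨fun i j hij => hdisj i j v (Subtype.mk.inj hij), by
      rw [Fintype.card_fin, card_ne, hV, Nat.add_sub_cancel]⟩
  have huniq : ∀ i x y, (F i).Adj x y → y = f i x := fun i x y hxy => by
    obtain ⟨j, hj⟩ := (hbij x).2 ⟨y, hD.ne ((F i).adj_sub hxy)⟩
    have hj : f j x = y := congrArg Subtype.val hj
    have hij : i = j := by
      by_contra hne
      exact h₂ i j hne x y ⟨hxy, hj ▸ hf j x⟩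
    rw [hij, hj]
  have hit : ∀ i x y, ∃ t, (f i)^[t] x = y := fun i x y =>
    exists_iterate_eq (huniq i) ((h₁ i).1 x ((h₁ i).2 (Finset.mem_coe.2 (Finset.mem_univ x))) y
      ((h₁ i).2 (Finset.mem_coe.2 (Finset.mem_univ y))))
  let e : V ≃ Fin (m + 1) := Fintype.equivFinOfCardEq hV
  have hidx : ∀ a, 1 ≤ a → a < m + 1 → ∃ i, (e (f i (e.symm 0))).val = a := fun a ha ham => by
    obtain ⟨i, hi⟩ := (hbij (e.symm 0)).2 ⟨e.symm ⟨a, ham⟩, fun h => by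
      have := congrArg Fin.val (e.symm.injective h)
      simp at this
      omega⟩
    have hi : f i (e.symm 0) = e.symm ⟨a, ham⟩ := congrArg Subtype.val hi
    exact ⟨i, by simp [hi]⟩
  have : Nonempty (Fin m) := ⟨⟨0, hm⟩⟩
  choose! idx hidx using hidx
  have hmem : ∀ a ∈ List.range' 1 m, 1 ≤ a ∧ a < m + 1 := fun a ha => by
    rw [List.mem_range'_1] at ha
    omega
  refine searchCycles_eq_true hm (fun a x => e (f (idx a) (e.symm x))) _ _ List.nodup_range'
    (fun a _ x y => ?_) (fun a ha => hidx a (hmem a ha).1 (hmem a ha).2)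
    (fun a ha b hb hab x hx => hab ?_) (fun _ _ _ => List.not_mem_nil)
  · obtain ⟨t, ht⟩ := hit (idx a) (e.symm x) (e.symm y)
    refine ⟨t, ?_⟩
    have hsemi : Function.Semiconj e (f (idx a)) fun x => e (f (idx a) (e.symm x)) :=
      fun x => by simp
    have := (hsemi.iterate_right t).eq (e.symm x)
    rw [ht] at this
    simpa using this.symm
  · rw [← hidx a (hmem a ha).1 (hmem a ha).2, ← hidx b (hmem b hb).1 (hmem b hb).2,
      hdisj _ _ _ (e.injective hx)]

/-- The complete digraphs of orders `4` and `6` have no Hamiltonian decomposition. -/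
theorem not_hasPacking_univ {V : Type*} [Fintype V] {D : Digraph V} (hD : Loopless D)
    (hV : Fintype.card V = 4 ∨ Fintype.card V = 6) :
    ¬ HasPacking D Finset.univ (Fintype.card V - 1) := by
  intro h
  rcases hV with hV | hV <;> rw [hV] at h
  · exact Bool.false_ne_true (searchCycles_four.symm.trans (h.searchCycles (by omega) hV hD))
  · exact Bool.false_ne_true (searchCycles_six.symm.trans (h.searchCycles (by omega) hV hD))

/-! ### The values of `λ_k` -/

theorem hasPacking_of_complete {V : Type*} [Fintype V] {D : Digraph V}
    (hD : ∀ x y, D.Adj x y ↔ x ≠ y) {k : ℕ} (hk : 2 ≤ k)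
    (hkV : ¬ (k = 4 ∨ k = 6) ∨ ((k = 4 ∨ k = 6) ∧ k < Fintype.card V)) {S : Finset V}
    (hS : S.card = k) : HasPacking D S (Fintype.card V - 1) := by
  -- if `|S|` is `4` or `6`, one vertex outside `S` is added to reach an odd order
  obtain ⟨T, hST, hT₂, hT₄, hT₆⟩ : ∃ T, S ⊆ T ∧ 2 ≤ T.card ∧ T.card ≠ 4 ∧ T.card ≠ 6 := by
    by_cases hk' : k = 4 ∨ k = 6
    · have hlt : k < Fintype.card V := by tauto
      obtain ⟨T, hST, hT⟩ := Finset.exists_superset_card_eq (s := S) (n := k + 1)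
        (by omega) (by omega)
      exact ⟨T, hST, by omega, by omega, by omega⟩
    · exact ⟨S, subset_rfl, by omega, by omega, by omega⟩
  exact hasPacking_of_strongColouring (ι := Fin (T.card - 1)) hD hST
    (by rw [Fintype.card_fin]; omega)
    (strongColouring_of_card (by rwa [Fintype.card_coe]) (by rwa [Fintype.card_coe])
      (by rwa [Fintype.card_coe]) (by rw [Fintype.card_coe, Fintype.card_fin]; omega))

theorem lam_eq_of_complete {V : Type*} [Fintype V] {D : Digraph V}
    (hD : ∀ x y, D.Adj x y ↔ x ≠ y) {k : ℕ} (hk : 2 ≤ k) (hkV : k ≤ Fintype.card V)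
    (hk' : ¬ (k = 4 ∨ k = 6) ∨ ((k = 4 ∨ k = 6) ∧ k < Fintype.card V)) :
    lam D k = ((Fintype.card V - 1 : ℕ) : ℕ∞) :=
  le_antisymm (lam_le_card_sub_one (fun v h => (hD v v).1 h rfl) hk hkV)
    (natCast_le_lam.2 fun _ hS => hasPacking_of_complete hD hk hk' hS)

theorem complete_of_lam_eq {V : Type*} [Fintype V] {D : Digraph V} (hD : Loopless D) {k : ℕ}
    (hk : 2 ≤ k) (hkV : k ≤ Fintype.card V) (h : lam D k = ((Fintype.card V - 1 : ℕ) : ℕ∞))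
    (x y : V) : D.Adj x y ↔ x ≠ y := by
  refine ⟨fun hxy => (hD.ne hxy).symm, fun hxy => ?_⟩
  obtain ⟨S, hxS, hS⟩ := Finset.exists_superset_card_eq (s := {x}) (n := k)
    (by rw [Finset.card_singleton]; omega) hkV
  exact adj_of_hasPacking_card_sub_one (natCast_le_lam.1 h.ge S hS) hD (hS ▸ hk)
    (hxS (Finset.mem_singleton_self x)) hxy

theorem isomorphic_completeDigraph_iff {V : Type*} [Fintype V] {D : Digraph V} {n : ℕ}
    (hV : Fintype.card V = n) :
    Isomorphic D (completeDigraph n) ↔ ∀ x y, D.Adj x y ↔ x ≠ y := by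
  constructor
  · rintro ⟨e, he⟩ x y
    rw [he]
    exact e.injective.ne_iff
  · intro h
    refine ⟨Fintype.equivFinOfCardEq hV, fun x y => ?_⟩
    rw [h]
    exact (Equiv.injective _).ne_iff.symm

theorem lam_eq_iff {V : Type*} [Fintype V] {D : Digraph V} (hD : Loopless D) {k : ℕ}
    (hk : 2 ≤ k) (hkV : k ≤ Fintype.card V) :
    lam D k = ((Fintype.card V - 1 : ℕ) : ℕ∞) ↔ (∀ x y, D.Adj x y ↔ x ≠ y) ∧
      (¬ (k = 4 ∨ k = 6) ∨ ((k = 4 ∨ k = 6) ∧ k < Fintype.card V)) := by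
  refine ⟨fun h => ⟨complete_of_lam_eq hD hk hkV h, ?_⟩, fun h => lam_eq_of_complete h.1 hk hkV h.2⟩
  by_contra hk'
  have hk46 : k = 4 ∨ k = 6 := by tauto
  have hkn : k = Fintype.card V := le_antisymm hkV (not_lt.1 (by tauto))
  exact not_hasPacking_univ hD (hkn ▸ hk46) (natCast_le_lam.1 h.ge Finset.univ hkn.symm)

/-- The directed cycle on `Fin n`. -/
def directedCycle (n : ℕ) [NeZero n] : Digraph (Fin n) where
  Adj x y := y = x + 1

theorem directedCycle_strong (n : ℕ) [NeZero n] : Strong (directedCycle n) := by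
  intro x y
  have key : ∀ t : ℕ, ReflTransGen (directedCycle n).Adj x (x + Fin.ofNat n t) := by
    intro t
    induction t with
    | zero => simpa using ReflTransGen.refl
    | succ t ih =>
      refine ih.tail (?_ : _ = _)
      rw [add_assoc]
      congr 1
      ext
      simp [Fin.val_add]
  simpa using key (y - x).val

theorem directedCycle_loopless {n : ℕ} [NeZero n] (hn : 2 ≤ n) : Loopless (directedCycle n) := by
  intro v (hv : v = v + 1)
  have := congrArg Fin.val (left_eq_add.1 hv)
  rw [Fin.val_one', Fin.val_zero, Nat.mod_eq_of_lt hn] at this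
  exact one_ne_zero this

end StrongSubgraph

theorem theorem2 (n k : ℕ) (hk : 2 ≤ k) (hkn : k ≤ n) :
    (∀ (V : Type*) [Fintype V] (D : Digraph V), Fintype.card V = n →
      StrongSubgraph.Loopless D → StrongSubgraph.Strong D →
        1 ≤ StrongSubgraph.lam D k ∧
        StrongSubgraph.lam D k ≤ ((n - 1 : ℕ) : ℕ∞) ∧
        (StrongSubgraph.lam D k = ((n - 1 : ℕ) : ℕ∞) ↔
          StrongSubgraph.Isomorphic D (StrongSubgraph.completeDigraph n) ∧
            (¬ (k = 4 ∨ k = 6) ∨ ((k = 4 ∨ k = 6) ∧ k < n)))) ∧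
    (∃ D : Digraph (Fin n), StrongSubgraph.Loopless D ∧ StrongSubgraph.Strong D ∧
      StrongSubgraph.lam D k = 1) ∧
    ((¬ (k = 4 ∨ k = 6) ∨ ((k = 4 ∨ k = 6) ∧ k < n)) →
      ∃ D : Digraph (Fin n), StrongSubgraph.Loopless D ∧ StrongSubgraph.Strong D ∧
        StrongSubgraph.lam D k = ((n - 1 : ℕ) : ℕ∞)) := by
  refine ⟨?_, ?_, fun hk' => ?_⟩
  · rintro V _ D rfl hD hs
    exact ⟨hs.one_le_lam k, StrongSubgraph.lam_le_card_sub_one hD hk hkn, by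
      rw [StrongSubgraph.isomorphic_completeDigraph_iff rfl, StrongSubgraph.lam_eq_iff hD hk hkn]⟩
  · have : NeZero n := ⟨by omega⟩
    exact ⟨StrongSubgraph.directedCycle n, StrongSubgraph.directedCycle_loopless (by omega),
      StrongSubgraph.directedCycle_strong n,
      StrongSubgraph.lam_eq_one_of_adj_unique (StrongSubgraph.directedCycle_strong n)
        (fun x y z hy hz => Eq.trans hy (Eq.symm hz)) hk (by rwa [Fintype.card_fin])⟩
  · refine ⟨StrongSubgraph.completeDigraph n, fun v h => h rfl, fun x y => ?_, ?_⟩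
    · by_cases hxy : x = y
      · exact hxy ▸ .refl
      · exact .single hxy
    · simpa using StrongSubgraph.lam_eq_of_complete (D := StrongSubgraph.completeDigraph n)
        (fun _ _ => Iff.rfl) hk (by rwa [Fintype.card_fin]) (by rwa [Fintype.card_fin])
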